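/- A planar map is a connected planar graph (loops and multiple edges allowed) embedded on the oriented sphere, considered up to orientation-preserving homeomorphism. A map is rooted if one of its edges is distinguished and directed (so it has at least one edge); its root face is the face to the left of the root edge, and all other faces are inner faces. The valency of a face is the number of edge sides on its boundary. All maps are rooted. A map $P$ occurs as a pattern in a map $M$ if $P$ is embedded in the sphere as a part of $M$, with $V(P)\subseteq V(M)$, $E(P)\subseteq E(M)$ and every inner face of $P$ an inner face of $M$. It occurs at the root of $M$ if, moreover, the directed root edge of $P$ is the directed root edge of $M$. A marked pattern $P$ in $M$ is a chosen occurrence in $M$ of a pattern isomorphic to $P$, whose root is forgotten, i.e. only its vertices, edges and inner faces are remembered. Let $\widehat m$ be a rooted planar map. Let $\tilde f_{\widehat m,n}$ be the number, up to isomorphism, of maps with $n$ edges together with an occurrence of $\widehat m$ as a pattern at the root (a map is counted once for each such occurrence), and let $t_{\widehat m,n}$ be the number, up to isomorphism, of maps with $n$ edges and a marked pattern $\widehat m$. Put $$\mathbb F_{\widehat m}(z)=\sum_{n\ge 0}\tilde f_{\widehat m,n}z^n,\qquad \mathbb T_{\widehat m}(z)=\sum_{n\ge 0}t_{\widehat m,n}z^n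 .$$ Let $|\mathscr I^{\Sigma}_{\widehat m}|$ be the sum of the valencies of the inner faces of $\widehat m$, and let $|\mathscr R_{\widehat m}|$ be the number of maps rotationally isomorphic to $\widehat m$, that is, the number of choices of a directed edge of $\widehat m$ with the root face on its left such that $\widehat m$ rerooted there is isomorphic to $\widehat m$ as a rooted map ($\widehat m$ itself included). Then, as formal power series, $$\mathbb T_{\widehat m}(z)=|\mathscr R_{\widehat m}|^{-1}\left(2z\,\frac{d}{dz}\mathbb F_{\widehat m}(z)-|\mathscr I^{\Sigma}_{\widehat m}|\,\mathbb F_{\widehat m}(z)\right).$$ -/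

import Mathlib

/-!
Planar maps are encoded by rotation systems on darts (directed edges), the standard combinatorial
description of connected graphs embedded in the oriented sphere up to orientation-preserving
homeomorphism.
-/

/-- A planar map with at least one edge, on the finite set `D` of darts (each edge is a pair of
opposite darts; loops and multiple edges are allowed). `rot d` is the dart following `d` in
counterclockwise order around the initial vertex of `d`, and `rev d` is `d` with the opposite
direction. Vertices, edges and faces are the cycles of `rot`, `rev` and `rot⁻¹ * rev`; the map is
connected, and planarity (genus zero) is Euler's relation `#V + #F = #E + 2`. -/
structure PlanarMap (D : Type*) [Finite D] where
  rot : Equiv.Perm D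
  rev : Equiv.Perm D
  rev_rev : ∀ d, rev (rev d) = d
  rev_ne : ∀ d, rev d ≠ d
  connected : ∀ d e, ∃ g ∈ Subgroup.closure {rot, rev}, g d = e
  euler : Nat.card (Quotient (Equiv.Perm.SameCycle.setoid rot)) +
      Nat.card (Quotient (Equiv.Perm.SameCycle.setoid (rot⁻¹ * rev))) =
    Nat.card (Quotient (Equiv.Perm.SameCycle.setoid rev)) + 2

namespace PlanarMap

variable {D : Type*} [Finite D] (M : PlanarMap D)

/-- The dart following `d` when walking along the boundary of the face on the left of `d`: at the
end vertex of `d`, turn clockwise from the reversed dart to the next dart. -/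
def next : Equiv.Perm D := M.rot⁻¹ * M.rev

/-- The vertices. -/
def Vertex : Type _ := Quotient (Equiv.Perm.SameCycle.setoid M.rot)

/-- The (undirected) edges. -/
def Edge : Type _ := Quotient (Equiv.Perm.SameCycle.setoid M.rev)

/-- The faces. -/
def Face : Type _ := Quotient (Equiv.Perm.SameCycle.setoid M.next)

/-- The initial vertex of a dart. -/
def vertexOf (d : D) : M.Vertex := Quotient.mk (Equiv.Perm.SameCycle.setoid M.rot) d

/-- The edge underlying a dart. -/
def edgeOf (d : D) : M.Edge := Quotient.mk (Equiv.Perm.SameCycle.setoid M.rev) d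

/-- The face on the left of a dart. -/
def faceOf (d : D) : M.Face := Quotient.mk (Equiv.Perm.SameCycle.setoid M.next) d

noncomputable instance : Fintype M.Face :=
  haveI : Finite M.Face := inferInstanceAs (Finite (Quotient _))
  Fintype.ofFinite _

/-- The valency of a face: the number of edge sides on its boundary (an edge having the face on
both of its sides counts twice). -/
noncomputable def valency (f : M.Face) : ℕ := Nat.card {d : D // M.faceOf d = f}

end PlanarMap

/-- A rooted planar map: a planar map with a distinguished directed edge. -/
structure RootedPlanarMap (D : Type*) [Finite D] extends PlanarMap D where
  root : D

namespace RootedPlanarMap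

variable {D D' D'' : Type*} [Finite D] [Finite D'] [Finite D'']

/-- The root face is the face on the left of the root edge. -/
def rootFace (M : RootedPlanarMap D) : M.Face := M.faceOf M.root

/-- The sum of the valencies of the inner faces, i.e. of all faces other than the root face. -/
noncomputable def innerValencySum (M : RootedPlanarMap D) : ℕ :=
  open Classical in ∑ f ∈ Finset.univ.filter (fun f : M.Face => f ≠ M.rootFace), M.valency f

/-- Isomorphisms of rooted planar maps (orientation-preserving, preserving the directed root). -/
structure Iso (M : RootedPlanarMap D) (N : RootedPlanarMap D') extends D ≃ D' where
  map_rot : ∀ d, toFun (M.rot d) = N.rot (toFun d)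
  map_rev : ∀ d, toFun (M.rev d) = N.rev (toFun d)
  map_root : toFun M.root = N.root

namespace Iso

/-- The identity isomorphism. -/
def refl (M : RootedPlanarMap D) : Iso M M where
  toEquiv := Equiv.refl D
  map_rot _ := rfl
  map_rev _ := rfl
  map_root := rfl

/-- The inverse isomorphism. -/
def symm {M : RootedPlanarMap D} {N : RootedPlanarMap D'} (g : Iso M N) : Iso N M where
  toEquiv := g.toEquiv.symm
  map_rot d := g.toEquiv.injective <| by
    have h := g.map_rot (g.toEquiv.symm d)
    simp only [Equiv.toFun_as_coe, Equiv.apply_symm_apply] at h ⊢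
    exact h.symm
  map_rev d := g.toEquiv.injective <| by
    have h := g.map_rev (g.toEquiv.symm d)
    simp only [Equiv.toFun_as_coe, Equiv.apply_symm_apply] at h ⊢
    exact h.symm
  map_root := g.toEquiv.injective <| by
    have h := g.map_root
    simp only [Equiv.toFun_as_coe, Equiv.apply_symm_apply] at h ⊢
    exact h.symm

/-- The composite isomorphism. -/
def trans {M : RootedPlanarMap D} {N : RootedPlanarMap D'} {K : RootedPlanarMap D''}
    (g : Iso M N) (h : Iso N K) : Iso M K where
  toEquiv := g.toEquiv.trans h.toEquiv
  map_rot d := (congrArg h.toFun (g.map_rot d)).trans (h.map_rot _)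
  map_rev d := (congrArg h.toFun (g.map_rev d)).trans (h.map_rev _)
  map_root := (congrArg h.toFun g.map_root).trans h.map_root

end Iso

/-- The rerooting of `M` at the directed edge `d`. -/
def reroot (M : RootedPlanarMap D) (d : D) : RootedPlanarMap D where
  toPlanarMap := M.toPlanarMap
  root := d

/-- `N` is rotationally isomorphic to `M`: it is a rerooting of `M` with the same root face, and it
is isomorphic to `M` as a rooted map. -/
def RotationallyIsomorphic (M N : RootedPlanarMap D) : Prop :=
  ∃ d : D, M.faceOf d = M.rootFace ∧ N = M.reroot d ∧ Nonempty (Iso N M)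

/-- The number of maps that are rotationally isomorphic to `M` (`M` itself included). -/
noncomputable def numRotations (M : RootedPlanarMap D) : ℕ :=
  Nat.card {N : RootedPlanarMap D // RotationallyIsomorphic M N}

/-- An identification of `P` with a pattern in `M`. -/
structure PatternEmbedding (P : RootedPlanarMap D) (M : RootedPlanarMap D') where
  toFun : D → D'
  /-- The edges of `P` are (distinct) edges of `M`. -/
  injective : Function.Injective toFun
  map_rev : ∀ d, toFun (P.rev d) = M.rev (toFun d)
  /-- The embedding of `P` is the restriction of that of `M`: the rotation of `P` around a vertex
  is the rotation of `M` with the darts outside `P` skipped. -/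
  map_rot : ∀ d, ∃ k : ℕ, 0 < k ∧ (M.rot ^ k) (toFun d) = toFun (P.rot d) ∧
    ∀ j : ℕ, 0 < j → j < k → (M.rot ^ j) (toFun d) ∉ Set.range toFun
  /-- Distinct vertices of `P` are distinct vertices of `M`. -/
  vertex_injective : ∀ d e, M.vertexOf (toFun d) = M.vertexOf (toFun e) →
    P.vertexOf d = P.vertexOf e
  /-- The inner faces of `P` are faces of `M`, with the same boundary walk. -/
  map_next : ∀ d, P.faceOf d ≠ P.rootFace → toFun (P.next d) = M.next (toFun d)
  /-- These faces are inner faces of `M`. -/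
  map_inner : ∀ d, P.faceOf d ≠ P.rootFace → M.faceOf (toFun d) ≠ M.rootFace

/-- A set of vertices, a set of edges and a set of faces of `M`. -/
structure Marking (M : RootedPlanarMap D) where
  vertices : Set M.Vertex
  edges : Set M.Edge
  faces : Set M.Face

/-- The vertices, edges and inner faces of the pattern, as parts of `M` (the root of the pattern is
forgotten). -/
def PatternEmbedding.marking {P : RootedPlanarMap D} {M : RootedPlanarMap D'}
    (i : PatternEmbedding P M) : Marking M where
  vertices := {v | ∃ d, M.vertexOf (i.toFun d) = v}
  edges := {e | ∃ d, M.edgeOf (i.toFun d) = e}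
  faces := {f | ∃ d, P.faceOf d ≠ P.rootFace ∧ M.faceOf (i.toFun d) = f}

/-- The marked part of `M` is a pattern isomorphic to `P`. -/
def Marking.IsPattern {M : RootedPlanarMap D'} (S : Marking M) (P : RootedPlanarMap D) : Prop :=
  ∃ i : PatternEmbedding P M, i.marking = S

/-- The marked part of `M` is a pattern isomorphic to `P` at the root of `M`: the directed root
edge of `P` is the directed root edge of `M`. -/
def Marking.IsPatternAtRoot {M : RootedPlanarMap D'} (S : Marking M) (P : RootedPlanarMap D) :
    Prop :=
  ∃ i : PatternEmbedding P M, i.marking = S ∧ i.toFun P.root = M.root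

end RootedPlanarMap

open RootedPlanarMap

/-- A rooted planar map with `n` edges (hence `2 * n` darts, labelled by `Fin (2 * n)`) together
with a marked part. -/
structure MarkedMap (n : ℕ) where
  map : RootedPlanarMap (Fin (2 * n))
  mark : Marking map

namespace MarkedMap

/-- Isomorphism of rooted planar maps with a marked part. -/
instance setoid (n : ℕ) : Setoid (MarkedMap n) where
  r A B := ∃ g : Iso A.map B.map,
    (∀ d, A.map.vertexOf d ∈ A.mark.vertices ↔ B.map.vertexOf (g.toFun d) ∈ B.mark.vertices) ∧
    (∀ d, A.map.edgeOf d ∈ A.mark.edges ↔ B.map.edgeOf (g.toFun d) ∈ B.mark.edges) ∧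
    (∀ d, A.map.faceOf d ∈ A.mark.faces ↔ B.map.faceOf (g.toFun d) ∈ B.mark.faces)
  iseqv :=
    { refl := fun A => ⟨Iso.refl _, fun _ => Iff.rfl, fun _ => Iff.rfl, fun _ => Iff.rfl⟩
      symm := by
        rintro A B ⟨g, h1, h2, h3⟩
        have key : ∀ d, g.toFun (g.symm.toFun d) = d := fun d => g.toEquiv.apply_symm_apply d
        refine ⟨g.symm, fun d => ?_, fun d => ?_, fun d => ?_⟩
        · rw [h1, key]
        · rw [h2, key]
        · rw [h3, key]
      trans := by
        rintro A B C ⟨g, h1, h2, h3⟩ ⟨k, k1, k2, k3⟩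
        exact ⟨g.trans k, fun d => (h1 d).trans (k1 _), fun d => (h2 d).trans (k2 _),
          fun d => (h3 d).trans (k3 _)⟩ }

end MarkedMap

section Counting

variable {D : Type*} [Finite D]

/-- The number of rooted planar maps with `n` edges and a marked pattern `P`, up to isomorphism. -/
noncomputable def numMarkedPattern (P : RootedPlanarMap D) (n : ℕ) : ℕ :=
  Nat.card {c : Quotient (MarkedMap.setoid n) // ∃ A : MarkedMap n,
    Quotient.mk (MarkedMap.setoid n) A = c ∧ A.mark.IsPattern P}

/-- The number of rooted planar maps with `n` edges and the pattern `P` occurring at the root, up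
to isomorphism; a map is counted once for each such occurrence. -/
noncomputable def numRootPattern (P : RootedPlanarMap D) (n : ℕ) : ℕ :=
  Nat.card {c : Quotient (MarkedMap.setoid n) // ∃ A : MarkedMap n,
    Quotient.mk (MarkedMap.setoid n) A = c ∧ A.mark.IsPatternAtRoot P}

/-- The generating function of maps with a marked pattern `P`. -/
noncomputable def markedPatternSeries (P : RootedPlanarMap D) : PowerSeries ℚ :=
  PowerSeries.mk fun n => (numMarkedPattern P n : ℚ)

/-- The generating function of maps with the pattern `P` at the root. -/
noncomputable def rootPatternSeries (P : RootedPlanarMap D) : PowerSeries ℚ :=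
  PowerSeries.mk fun n => (numRootPattern P n : ℚ)

end Counting

/-! Coefficientwise the claim is `t * |R| + |I| * f = 2 * n * f`, where `t` counts marked patterns,
`f` patterns at the root, `|R|` rotations of `P` and `|I|` the darts of inner faces of `P`. It comes
from counting labelled objects. Take an unrooted map on the darts `Fin (2 * n)` with an embedding of
`P`, and choose any of its `2 * n` darts. If the dart lies off the embedded inner faces, rooting
there gives an occurrence of `P`; otherwise it is the image of a unique inner dart of `P`. The
embedding alone amounts to an occurrence at the root, since the image of `P.root` prescribes the
root. This is `card_occurrence_add`. To remove labels, let relabellings and rotations of `P` act on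
labelled occurrences. By connectivity a rooted map has no nontrivial automorphism, so the action is
free. Its orbits are the isomorphism classes of marked maps (`IsOccurrence.markedMap_equiv_iff`),
because the marking determines the embedding up to rotation (`IsEmbedding.exists_rotation`). So a
class has `(2 * n)! * |R|` labelled occurrences, but only `(2 * n)!` at the root, where no
nontrivial rotation is allowed (`card_occurrence`). -/

namespace PlanarMap

variable {D D' : Type*} [Finite D] [Finite D']

/-! ### Unrooted maps: cells, rigidity, relabelling. -/

theorem vertexOf_eq_iff (M : PlanarMap D) {d e : D} :
    M.vertexOf d = M.vertexOf e ↔ M.rot.SameCycle d e := Quotient.eq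

theorem edgeOf_eq_iff_sameCycle (M : PlanarMap D) {d e : D} :
    M.edgeOf d = M.edgeOf e ↔ M.rev.SameCycle d e := Quotient.eq

theorem faceOf_eq_iff (M : PlanarMap D) {d e : D} :
    M.faceOf d = M.faceOf e ↔ M.next.SameCycle d e := Quotient.eq

theorem next_apply (M : PlanarMap D) (d : D) : M.next d = M.rot⁻¹ (M.rev d) := rfl

theorem faceOf_next_pow (M : PlanarMap D) (d : D) (n : ℕ) :
    M.faceOf ((M.next ^ n) d) = M.faceOf d :=
  M.faceOf_eq_iff.2 (Equiv.Perm.sameCycle_pow_left.2 (Equiv.Perm.SameCycle.refl _ _))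

theorem edgeOf_eq_iff (M : PlanarMap D) {d e : D} :
    M.edgeOf d = M.edgeOf e ↔ e = d ∨ e = M.rev d := by
  rw [edgeOf_eq_iff_sameCycle]
  constructor
  · intro h
    obtain ⟨n, rfl⟩ := h.exists_nat_pow_eq
    clear h
    induction n with
    | zero => simp
    | succ n ih =>
      rw [pow_succ', Equiv.Perm.mul_apply]
      rcases ih with h | h <;> rw [h]
      · exact Or.inr rfl
      · exact Or.inl (M.rev_rev d)
  · rintro (rfl | rfl)
    · exact Equiv.Perm.SameCycle.refl _ _
    · exact Equiv.Perm.sameCycle_apply_right.2 (Equiv.Perm.SameCycle.refl _ _)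

/-- Maps of darts that commute with `rot` and `rev` are determined by one value. -/
theorem eq_of_commute (M : PlanarMap D) (N : PlanarMap D') {a b : D → D'}
    (arot : ∀ d, a (M.rot d) = N.rot (a d)) (arev : ∀ d, a (M.rev d) = N.rev (a d))
    (brot : ∀ d, b (M.rot d) = N.rot (b d)) (brev : ∀ d, b (M.rev d) = N.rev (b d))
    {r : D} (hr : a r = b r) : a = b := by
  funext d
  obtain ⟨g, hg, rfl⟩ := M.connected r d
  -- The permutations of `D` that `a` and `b` both carry to one common permutation of `D'` form a
  -- subgroup containing `rot` and `rev`.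
  have key : ∃ k : Equiv.Perm D', ∀ x, a (g x) = k (a x) ∧ b (g x) = k (b x) := by
    induction hg using Subgroup.closure_induction with
    | mem x hx =>
      rcases hx with rfl | rfl
      · exact ⟨N.rot, fun x => ⟨arot x, brot x⟩⟩
      · exact ⟨N.rev, fun x => ⟨arev x, brev x⟩⟩
    | one => exact ⟨1, fun x => ⟨rfl, rfl⟩⟩
    | mul x y _ _ hx hy =>
      obtain ⟨k, hk⟩ := hx
      obtain ⟨l, hl⟩ := hy
      refine ⟨k * l, fun z => ?_⟩
      simp only [Equiv.Perm.mul_apply]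
      rw [(hk _).1, (hk _).2, (hl _).1, (hl _).2]
      exact ⟨rfl, rfl⟩
    | inv x _ hx =>
      obtain ⟨k, hk⟩ := hx
      refine ⟨k⁻¹, fun z => ?_⟩
      rw [Equiv.Perm.eq_inv_iff_eq, Equiv.Perm.eq_inv_iff_eq, ← (hk _).1, ← (hk _).2]
      simp
  obtain ⟨k, hk⟩ := key
  rw [(hk r).1, (hk r).2, hr]

theorem ext_rot_rev {M N : PlanarMap D} (h : M.rot = N.rot) (h' : M.rev = N.rev) : M = N := by
  cases M; cases N; cases h; cases h'; rfl

theorem card_cycles_conj {α : Type*} (p g : Equiv.Perm α) :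
    Nat.card (Quotient (Equiv.Perm.SameCycle.setoid (g * p * g⁻¹))) =
      Nat.card (Quotient (Equiv.Perm.SameCycle.setoid p)) := by
  refine Nat.card_congr (Quotient.congr g⁻¹ fun a b => ?_)
  exact Equiv.Perm.sameCycle_conj

/-- Relabelling of the darts. -/
def relabel (g : Equiv.Perm D) (M : PlanarMap D) : PlanarMap D where
  rot := g * M.rot * g⁻¹
  rev := g * M.rev * g⁻¹
  rev_rev d := by simp [M.rev_rev]
  rev_ne d h := M.rev_ne (g⁻¹ d) (by
    rw [Equiv.Perm.eq_inv_iff_eq]; exact h)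
  connected d e := by
    obtain ⟨h, hh, he⟩ := M.connected (g⁻¹ d) (g⁻¹ e)
    refine ⟨g * h * g⁻¹, ?_, ?_⟩
    · have := Subgroup.mem_map_of_mem (MulAut.conj g).toMonoidHom hh
      rw [MonoidHom.map_closure, Set.image_pair] at this
      exact this
    · rw [Equiv.Perm.mul_apply, Equiv.Perm.mul_apply, he]
      exact g.apply_symm_apply e
  euler := by
    have h : (g * M.rot * g⁻¹)⁻¹ * (g * M.rev * g⁻¹) = g * (M.rot⁻¹ * M.rev) * g⁻¹ := by group
    rw [h, card_cycles_conj, card_cycles_conj, card_cycles_conj, M.euler]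

theorem relabel_rot (g : Equiv.Perm D) (M : PlanarMap D) (d : D) :
    (M.relabel g).rot (g d) = g (M.rot d) := by simp [relabel]

theorem relabel_rev (g : Equiv.Perm D) (M : PlanarMap D) (d : D) :
    (M.relabel g).rev (g d) = g (M.rev d) := by simp [relabel]

instance : Finite (PlanarMap D) :=
  Finite.of_injective (fun M : PlanarMap D => (M.rot, M.rev)) fun _ _ h =>
    ext_rot_rev (congrArg Prod.fst h) (congrArg Prod.snd h)

end PlanarMap

/-! ### Embeddings of the pattern and their inner darts. -/

namespace RootedPlanarMap

variable {D D' : Type*} [Finite D] [Finite D']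

/-- An identification of the darts of `P` with darts of the unrooted map `M` under which the inner
faces of `P` are faces of `M`. -/
structure IsEmbedding (P : RootedPlanarMap D) (M : PlanarMap D') (f : D → D') : Prop where
  injective : Function.Injective f
  map_rev : ∀ d, f (P.rev d) = M.rev (f d)
  map_rot : ∀ d, ∃ k : ℕ, 0 < k ∧ (M.rot ^ k) (f d) = f (P.rot d) ∧
    ∀ j : ℕ, 0 < j → j < k → (M.rot ^ j) (f d) ∉ Set.range f
  vertex_injective : ∀ d e, M.vertexOf (f d) = M.vertexOf (f e) → P.vertexOf d = P.vertexOf e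
  map_next : ∀ d, P.faceOf d ≠ P.rootFace → f (P.next d) = M.next (f d)

/-- The darts on the boundaries of the inner faces. -/
def innerDarts (P : RootedPlanarMap D) : Set D := {d | P.faceOf d ≠ P.rootFace}

theorem root_notMem_innerDarts (P : RootedPlanarMap D) : P.root ∉ P.innerDarts := fun h => h rfl

theorem card_innerDarts (P : RootedPlanarMap D) : Nat.card P.innerDarts = P.innerValencySum := by
  classical
  have := Fintype.ofFinite D
  unfold innerValencySum PlanarMap.valency
  simp only [Nat.card_eq_fintype_card, Fintype.card_subtype, Set.coe_eq_subtype, innerDarts,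
    Set.mem_ofPred_eq]
  rw [Finset.card_eq_sum_card_fiberwise (f := P.faceOf)
    (t := Finset.univ.filter fun f => f ≠ P.rootFace) (fun d hd => by simpa using hd)]
  refine Finset.sum_congr (by congr) fun f hf => ?_
  congr 1
  ext d
  simp only [Finset.mem_filter, Finset.mem_univ, true_and] at hf ⊢
  exact ⟨fun h => h.2, fun h => ⟨h ▸ hf, h⟩⟩

namespace IsEmbedding

variable {P : RootedPlanarMap D} {M : PlanarMap D'} {f : D → D'}

theorem map_next_pow (h : IsEmbedding P M f) {d : D} (hd : d ∈ P.innerDarts) (n : ℕ) :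
    (M.next ^ n) (f d) = f ((P.next ^ n) d) := by
  induction n with
  | zero => rfl
  | succ n ih =>
    rw [pow_succ', pow_succ', Equiv.Perm.mul_apply, Equiv.Perm.mul_apply, ih, h.map_next]
    rwa [P.faceOf_next_pow]

/-- On an inner face `f` intertwines the two `next` permutations, so the whole boundary cycle in `M`
is the image of the boundary cycle in `P`. -/
theorem exists_of_faceOf_eq (h : IsEmbedding P M f) {d : D} (hd : d ∈ P.innerDarts) {y : D'}
    (hy : M.faceOf (f d) = M.faceOf y) : ∃ e ∈ P.innerDarts, f e = y := by
  obtain ⟨n, rfl⟩ := (M.faceOf_eq_iff.1 hy).exists_nat_pow_eq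
  refine ⟨(P.next ^ n) d, ?_, (h.map_next_pow hd n).symm⟩
  unfold innerDarts
  rwa [Set.mem_ofPred_eq, P.faceOf_next_pow]

theorem faceOf_eq_iff_inner (h : IsEmbedding P M f) {y : D'} :
    (∃ d, P.faceOf d ≠ P.rootFace ∧ M.faceOf (f d) = M.faceOf y) ↔ y ∈ f '' P.innerDarts :=
  ⟨fun ⟨_, hd, hy⟩ => h.exists_of_faceOf_eq hd hy, fun ⟨d, hd, hy⟩ => ⟨d, hd, hy ▸ rfl⟩⟩

/-- The range is closed under `rev`, so the marked edges determine the range of the embedding. -/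
theorem edgeOf_mem_iff (h : IsEmbedding P M f) {y : D'} :
    (∃ d, M.edgeOf (f d) = M.edgeOf y) ↔ y ∈ Set.range f := by
  constructor
  · rintro ⟨d, hd⟩
    rcases M.edgeOf_eq_iff.1 hd with rfl | rfl
    · exact ⟨d, rfl⟩
    · exact ⟨P.rev d, h.map_rev d⟩
  · rintro ⟨d, rfl⟩
    exact ⟨d, rfl⟩

/-- The pattern embedding into the rooted map. -/
def toPatternEmbedding {M : RootedPlanarMap D'} (h : IsEmbedding P M.toPlanarMap f)
    (hr : M.root ∉ f '' P.innerDarts) : PatternEmbedding P M where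
  toFun := f
  injective := h.injective
  map_rev := h.map_rev
  map_rot := h.map_rot
  vertex_injective := h.vertex_injective
  map_next := h.map_next
  -- Faces of `M` met by embedded inner darts consist only of such darts, so avoiding the root face
  -- reduces to a condition on the single dart `M.root`.
  map_inner d hd he := hr (h.faceOf_eq_iff_inner.1 ⟨d, hd, he⟩)

theorem relabel {M : PlanarMap D'} (h : IsEmbedding P M f) (g : Equiv.Perm D') :
    IsEmbedding P (M.relabel g) (g ∘ f) where
  injective := g.injective.comp h.injective
  map_rev d := by
    simp only [Function.comp_apply, M.relabel_rev, h.map_rev]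
  map_rot d := by
    have key : ∀ (k : ℕ) x, ((M.relabel g).rot ^ k) (g x) = g ((M.rot ^ k) x) := by
      intro k x
      simp [PlanarMap.relabel, conj_pow]
    obtain ⟨k, hk, hk', hj⟩ := h.map_rot d
    refine ⟨k, hk, ?_, fun j hj0 hjk => ?_⟩
    · simp only [Function.comp_apply, key, hk']
    · rintro ⟨e, he⟩
      simp only [Function.comp_apply, key] at he
      exact hj j hj0 hjk ⟨e, g.injective he⟩
  vertex_injective d e hde := by
    refine h.vertex_injective d e ?_
    rw [PlanarMap.vertexOf_eq_iff] at hde ⊢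
    have := Equiv.Perm.sameCycle_conj.1 hde
    simpa using this
  map_next d hd := by
    simp only [Function.comp_apply, h.map_next d hd]
    simp [PlanarMap.next, PlanarMap.relabel]

end IsEmbedding

theorem PatternEmbedding.isEmbedding {P : RootedPlanarMap D} {M : RootedPlanarMap D'}
    (i : PatternEmbedding P M) : IsEmbedding P M.toPlanarMap i.toFun where
  injective := i.injective
  map_rev := i.map_rev
  map_rot := i.map_rot
  vertex_injective := i.vertex_injective
  map_next := i.map_next

theorem PatternEmbedding.root_notMem {P : RootedPlanarMap D} {M : RootedPlanarMap D'}
    (i : PatternEmbedding P M) : M.root ∉ i.toFun '' P.innerDarts := by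
  rintro ⟨d, hd, h⟩
  exact i.map_inner d hd (h ▸ rfl)

/-! ### Rotations of the pattern. -/

/-- The automorphisms of the unrooted map that preserve the root face. -/
def rotations (P : RootedPlanarMap D) : Set (Equiv.Perm D) :=
  {s | (∀ d, s (P.rot d) = P.rot (s d)) ∧ (∀ d, s (P.rev d) = P.rev (s d)) ∧
    P.faceOf (s P.root) = P.rootFace}

/-- By rigidity an automorphism is determined by the image of the root, hence by the rerooting at
that image. -/
theorem card_rotations (P : RootedPlanarMap D) : Nat.card P.rotations = P.numRotations := by
  refine Nat.card_congr (Equiv.ofBijective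
    (fun s : P.rotations => ⟨P.reroot (s.1 P.root), s.1 P.root, s.2.2.2, rfl,
      ⟨Iso.symm (M := P) (N := P.reroot (s.1 P.root)) ⟨s.1, s.2.1, s.2.2.1, rfl⟩⟩⟩) ⟨?_, ?_⟩)
  · rintro ⟨s, hs⟩ ⟨t, ht⟩ h
    have hr : s P.root = t P.root := congrArg (fun N => RootedPlanarMap.root N.1) h
    exact Subtype.ext (Equiv.coe_fn_injective
      (P.eq_of_commute P.toPlanarMap hs.1 hs.2.1 ht.1 ht.2.1 hr))
  · rintro ⟨N, d, hd, rfl, ⟨g⟩⟩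
    have hr : g.symm.toFun P.root = d := g.symm.map_root
    refine ⟨⟨g.symm.toEquiv, g.symm.map_rot, g.symm.map_rev, ?_⟩, ?_⟩
    · exact (congrArg P.faceOf hr).trans hd
    · exact Subtype.ext (congrArg P.reroot hr)

theorem rotations_next {P : RootedPlanarMap D} {s : Equiv.Perm D} (hs : s ∈ P.rotations) (d : D) :
    s (P.next d) = P.next (s d) := by
  rw [P.next_apply, P.next_apply, Equiv.Perm.eq_inv_iff_eq, ← hs.1, ← hs.2.1]
  simp

/-- An automorphism permutes the faces, and a rotation fixes the root face, so the inner faces are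
permuted among themselves. -/
theorem rotations_mem_innerDarts {P : RootedPlanarMap D} {s : Equiv.Perm D} (hs : s ∈ P.rotations)
    {d : D} : s d ∈ P.innerDarts ↔ d ∈ P.innerDarts := by
  have h : s * P.next * s⁻¹ = P.next := by
    rw [mul_inv_eq_iff_eq_mul]
    exact Equiv.ext (rotations_next hs)
  simp only [innerDarts, Set.mem_ofPred_eq, ne_eq, not_iff_not]
  nth_rw 1 [← hs.2.2]
  rw [show P.rootFace = P.faceOf P.root from rfl, P.faceOf_eq_iff, P.faceOf_eq_iff]
  conv_lhs => rw [← h]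
  rw [Equiv.Perm.sameCycle_conj]
  simp

theorem image_innerDarts_comp {P : RootedPlanarMap D} {s : Equiv.Perm D} (hs : s ∈ P.rotations)
    {α : Type*} (f : D → α) : (f ∘ s) '' P.innerDarts = f '' P.innerDarts := by
  ext y
  constructor
  · rintro ⟨d, hd, rfl⟩
    exact ⟨s d, (rotations_mem_innerDarts hs).2 hd, rfl⟩
  · rintro ⟨d, hd, rfl⟩
    exact ⟨s.symm d, (rotations_mem_innerDarts hs).1 (by simpa using hd), by simp⟩

namespace IsEmbedding

variable {P : RootedPlanarMap D} {M : PlanarMap D'} {f f' : D → D'}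

theorem comp_rotation (h : IsEmbedding P M f) {s : Equiv.Perm D} (hs : s ∈ P.rotations) :
    IsEmbedding P M (f ∘ s) where
  injective := h.injective.comp s.injective
  map_rev d := by simp only [Function.comp_apply, hs.2.1, h.map_rev]
  map_rot d := by
    simpa only [Function.comp_apply, hs.1, s.surjective.range_comp] using h.map_rot (s d)
  vertex_injective d e hde := by
    have := h.vertex_injective (s d) (s e) hde
    have hc : s * P.rot * s⁻¹ = P.rot := by
      rw [mul_inv_eq_iff_eq_mul]
      exact Equiv.ext hs.1
    rw [PlanarMap.vertexOf_eq_iff] at this ⊢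
    rw [← hc, Equiv.Perm.sameCycle_conj] at this
    simpa using this
  map_next d hd := by
    simp only [Function.comp_apply, rotations_next hs]
    exact h.map_next _ ((rotations_mem_innerDarts hs).2 hd)

/-- Two embeddings with the same darts and the same inner faces differ by a rotation. -/
theorem exists_rotation (h : IsEmbedding P M f) (h' : IsEmbedding P M f')
    (hr : Set.range f = Set.range f') (hi : f '' P.innerDarts = f' '' P.innerDarts) :
    ∃ s ∈ P.rotations, f' = f ∘ s := by
  have hex : ∀ d, ∃ e, f e = f' d := fun d => by
    have : f' d ∈ Set.range f := hr ▸ ⟨d, rfl⟩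
    exact this
  choose s hs using hex
  have hinj : Function.Injective s := fun a b hab => h'.injective (by rw [← hs, ← hs, hab])
  refine ⟨Equiv.ofBijective s (Finite.injective_iff_bijective.1 hinj), ⟨?_, ?_, ?_⟩, ?_⟩
  · intro d
    simp only [Equiv.ofBijective_apply]
    apply h.injective
    rw [hs]
    obtain ⟨k, hk, hk', hj⟩ := h'.map_rot d
    obtain ⟨l, hl, hl', hj'⟩ := h.map_rot (s d)
    rw [hs] at hl' hj'
    -- Both exponents are the first return time of `M.rot` from `f' d` to the common range.
    have hkl : k = l := by
      rcases lt_trichotomy k l with hlt | heq | hlt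
      · exact absurd (hr ▸ ⟨_, hk'.symm⟩) (hj' k hk hlt)
      · exact heq
      · exact absurd (hr ▸ ⟨_, hl'.symm⟩) (hj l hl hlt)
    rw [← hk', ← hl', hkl]
  · intro d
    simp only [Equiv.ofBijective_apply]
    apply h.injective
    rw [hs, h.map_rev, hs, h'.map_rev]
  -- The inner darts have the same image under both embeddings, so `s` cannot send the root to an
  -- inner dart.
  · by_contra hne
    have : f (s P.root) ∈ f '' P.innerDarts := ⟨_, hne, rfl⟩
    rw [hs, hi, h'.injective.mem_set_image] at this
    exact P.root_notMem_innerDarts this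
  · funext d
    exact (hs d).symm

end IsEmbedding

/-! ### Relabelling of rooted maps. -/

theorem ext_root {M N : RootedPlanarMap D} (h : M.toPlanarMap = N.toPlanarMap)
    (h' : M.root = N.root) : M = N := by
  cases M; cases N; cases h; cases h'; rfl

instance : Finite (RootedPlanarMap D) :=
  Finite.of_injective (fun M : RootedPlanarMap D => (M.toPlanarMap, M.root)) fun _ _ h =>
    ext_root (congrArg Prod.fst h) (congrArg Prod.snd h)

/-- Relabelling of the darts. -/
def relabelRooted (g : Equiv.Perm D) (M : RootedPlanarMap D) : RootedPlanarMap D where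
  toPlanarMap := M.relabel g
  root := g M.root

/-- This is freeness of relabelling: `g` and `g'` are isomorphisms onto the same map that agree at
the root, so rigidity applies. -/
theorem relabelRooted_injective (M : RootedPlanarMap D) {g g' : Equiv.Perm D}
    (h : M.relabelRooted g = M.relabelRooted g') : g = g' := by
  have hp : M.relabel g = M.relabel g' := congrArg toPlanarMap h
  refine Equiv.coe_fn_injective (M.eq_of_commute (M.relabel g) (fun d => ?_) (fun d => ?_)
    (fun d => ?_) (fun d => ?_) (congrArg root h : g M.root = g' M.root))
  · rw [M.relabel_rot]
  · rw [M.relabel_rev]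
  · rw [hp, M.relabel_rot]
  · rw [hp, M.relabel_rev]

theorem Iso.eq_relabelRooted {M N : RootedPlanarMap D} (g : Iso M N) :
    N = M.relabelRooted g.toEquiv := by
  refine ext_root (PlanarMap.ext_rot_rev (Equiv.ext fun d => ?_) (Equiv.ext fun d => ?_))
    g.map_root.symm
  · obtain ⟨d, rfl⟩ := g.toEquiv.surjective d
    exact (g.map_rot d).symm.trans (M.relabel_rot _ d).symm
  · obtain ⟨d, rfl⟩ := g.toEquiv.surjective d
    exact (g.map_rev d).symm.trans (M.relabel_rev _ d).symm

/-- Relabelling is an isomorphism. -/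
def relabelIso (g : Equiv.Perm D) (M : RootedPlanarMap D) : Iso M (M.relabelRooted g) where
  toEquiv := g
  map_rot d := (M.relabel_rot g d).symm
  map_rev d := (M.relabel_rev g d).symm
  map_root := rfl

/-! ### Labelled occurrences and isomorphism of marked maps. -/

/-- A rooted map with an embedding of `P` that avoids the root face is an occurrence of `P`. -/
def IsOccurrence (P : RootedPlanarMap D) (M : RootedPlanarMap D') (f : D → D') : Prop :=
  IsEmbedding P M.toPlanarMap f ∧ M.root ∉ f '' P.innerDarts

namespace IsOccurrence

variable {P : RootedPlanarMap D}

theorem relabel_comp {M : RootedPlanarMap D'} {f : D → D'} (h : IsOccurrence P M f)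
    (g : Equiv.Perm D') {s : Equiv.Perm D} (hs : s ∈ P.rotations) :
    IsOccurrence P (M.relabelRooted g) (g ∘ f ∘ s) := by
  refine ⟨(h.1.comp_rotation hs).relabel g, ?_⟩
  rw [Set.image_comp, image_innerDarts_comp hs]
  rintro ⟨y, hy, he⟩
  obtain rfl : y = M.root := g.injective he
  exact h.2 hy

/-- The rooted map with the marked occurrence. -/
def markedMap {n : ℕ} {M : RootedPlanarMap (Fin (2 * n))} {f : D → Fin (2 * n)}
    (h : IsOccurrence P M f) : MarkedMap n :=
  ⟨M, (h.1.toPatternEmbedding h.2).marking⟩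

/-- Marked edges recover the range of the embedding and marked faces the image of the inner darts;
these fix it up to rotation. Marked vertices add nothing, being the ends of marked edges. -/
theorem markedMap_equiv_iff {n : ℕ} {M M' : RootedPlanarMap (Fin (2 * n))}
    {f f' : D → Fin (2 * n)} (h : IsOccurrence P M f) (h' : IsOccurrence P M' f') :
    MarkedMap.setoid n h.markedMap h'.markedMap ↔
      ∃ g : Equiv.Perm (Fin (2 * n)), ∃ s ∈ P.rotations,
        M' = M.relabelRooted g ∧ f' = g ∘ f ∘ s := by
  constructor
  · rintro ⟨g, -, he, hf⟩
    have hM : M' = M.relabelRooted g.toEquiv := g.eq_relabelRooted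
    have hg : IsEmbedding P M'.toPlanarMap (g.toEquiv ∘ f) :=
      (congrArg toPlanarMap hM).symm ▸ h.1.relabel g.toEquiv
    have he' : ∀ d, d ∈ Set.range f ↔ g.toEquiv d ∈ Set.range f' := fun d =>
      (h.1.edgeOf_mem_iff.symm.trans (he d)).trans h'.1.edgeOf_mem_iff
    have hf' : ∀ d, d ∈ f '' P.innerDarts ↔ g.toEquiv d ∈ f' '' P.innerDarts := fun d =>
      (h.1.faceOf_eq_iff_inner.symm.trans (hf d)).trans h'.1.faceOf_eq_iff_inner
    obtain ⟨s, hs, hfs⟩ := hg.exists_rotation h'.1 (by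
      ext y
      obtain ⟨d, rfl⟩ := g.toEquiv.surjective y
      rw [← he', Set.range_comp, g.toEquiv.injective.mem_set_image]) (by
      ext y
      obtain ⟨d, rfl⟩ := g.toEquiv.surjective y
      rw [← hf', Set.image_comp, g.toEquiv.injective.mem_set_image])
    exact ⟨g.toEquiv, s, hs, hM, hfs⟩
  · rintro ⟨g, s, hs, rfl, rfl⟩
    refine ⟨M.relabelIso g, fun y => ?_, fun y => ?_, fun y => ?_⟩
    · change (∃ d, M.vertexOf (f d) = M.vertexOf y) ↔
        ∃ d, (M.relabel g).vertexOf (g (f (s d))) = (M.relabel g).vertexOf (g y)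
      have key : ∀ a b, (M.relabel g).vertexOf (g a) = (M.relabel g).vertexOf (g b) ↔
          M.vertexOf a = M.vertexOf b := fun a b => by
        rw [PlanarMap.vertexOf_eq_iff, PlanarMap.vertexOf_eq_iff]
        exact Equiv.Perm.sameCycle_conj.trans (by simp)
      simp only [key]
      exact (s.surjective.exists (p := fun d => M.vertexOf (f d) = M.vertexOf y))
    · refine h.1.edgeOf_mem_iff.trans (Iff.trans ?_ h'.1.edgeOf_mem_iff.symm)
      change y ∈ Set.range f ↔ g y ∈ Set.range ((g ∘ f) ∘ s)
      rw [s.surjective.range_comp, Set.range_comp]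
      exact g.injective.mem_set_image.symm
    · refine h.1.faceOf_eq_iff_inner.trans (Iff.trans ?_ h'.1.faceOf_eq_iff_inner.symm)
      change y ∈ f '' P.innerDarts ↔ g y ∈ (g ∘ f ∘ s) '' P.innerDarts
      rw [Set.image_comp, image_innerDarts_comp hs]
      exact g.injective.mem_set_image.symm

end IsOccurrence

/-! ### Orbit counting. -/

/-- The occurrences of `P` in labelled rooted maps that satisfy `Q`. -/
def Occurrence (P : RootedPlanarMap D) (n : ℕ)
    (Q : RootedPlanarMap (Fin (2 * n)) → (D → Fin (2 * n)) → Prop) : Type _ :=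
  {x : RootedPlanarMap (Fin (2 * n)) × (D → Fin (2 * n)) // IsOccurrence P x.1 x.2 ∧ Q x.1 x.2}

/-- Finiteness keeps `Nat.card` from its default value 0, so that cardinalities add up over classes.
-/
instance (P : RootedPlanarMap D) (n : ℕ)
    (Q : RootedPlanarMap (Fin (2 * n)) → (D → Fin (2 * n)) → Prop) : Finite (Occurrence P n Q) :=
  inferInstanceAs (Finite (Subtype _))

/-- The isomorphism class of the map with the marked occurrence. -/
def Occurrence.toClass {P : RootedPlanarMap D} {n : ℕ}
    {Q : RootedPlanarMap (Fin (2 * n)) → (D → Fin (2 * n)) → Prop} (x : Occurrence P n Q) :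
    Quotient (MarkedMap.setoid n) := Quotient.mk _ x.2.1.markedMap

/-- Orbit counting: `H` is the set of rotations of the pattern compatible with `Q`. -/
theorem card_occurrence (P : RootedPlanarMap D) (n : ℕ)
    (Q : RootedPlanarMap (Fin (2 * n)) → (D → Fin (2 * n)) → Prop) (H : Set (Equiv.Perm D))
    (hH : H ⊆ P.rotations)
    (hQ : ∀ M f g, ∀ s ∈ P.rotations, IsOccurrence P M f → Q M f →
      (Q (M.relabelRooted g) (g ∘ f ∘ s) ↔ s ∈ H)) :
    Nat.card (Occurrence P n Q) =
      Nat.card (Set.range (Occurrence.toClass (P := P) (Q := Q))) *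
        ((2 * n).factorial * Nat.card H) := by
  have : Finite (Set.range (Occurrence.toClass (P := P) (n := n) (Q := Q))) :=
    Set.finite_range _
  have := Fintype.ofFinite (Set.range (Occurrence.toClass (P := P) (n := n) (Q := Q)))
  rw [Nat.card_congr (Equiv.sigmaFiberEquiv
    (Set.rangeFactorization (Occurrence.toClass (P := P) (n := n) (Q := Q)))).symm, Nat.card_sigma,
    Nat.card_eq_fintype_card (α := Set.range _), ← smul_eq_mul, ← Finset.card_univ,
    ← Finset.sum_const]
  refine Finset.sum_congr rfl ?_
  rintro ⟨_, ⟨⟨M, f⟩, h, hq⟩, rfl⟩ -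
  have hcard : Nat.card (Equiv.Perm (Fin (2 * n)) × H) = (2 * n).factorial * Nat.card H := by
    rw [Nat.card_prod, Nat.card_perm, Nat.card_fin]
  rw [← hcard]
  -- The fibre over a class is parametrised by pairs `(g, s)` with `s ∈ H`. Injectivity holds
  -- because the rooted map determines `g` and, `f` being injective, the embedding then determines
  -- `s`; surjectivity is `markedMap_equiv_iff`.
  refine (Nat.card_congr (Equiv.ofBijective (fun x : Equiv.Perm (Fin (2 * n)) × H =>
    ⟨⟨(M.relabelRooted x.1, x.1 ∘ f ∘ x.2.1), h.relabel_comp x.1 (hH x.2.2),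
      (hQ M f x.1 x.2.1 (hH x.2.2) h hq).2 x.2.2⟩,
    Subtype.ext (Quotient.sound (Setoid.symm ((h.markedMap_equiv_iff
      (h.relabel_comp x.1 (hH x.2.2))).2 ⟨x.1, x.2.1, hH x.2.2, rfl, rfl⟩)))⟩) ⟨?_, ?_⟩)).symm
  · rintro ⟨g, s, hs⟩ ⟨g', s', hs'⟩ he
    have hp := congrArg (fun x => x.1.1) he
    dsimp only at hp h
    obtain rfl : g = g' := M.relabelRooted_injective (congrArg Prod.fst hp)
    have hf : g ∘ f ∘ s = g ∘ f ∘ s' := congrArg Prod.snd hp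
    obtain rfl : s = s' := Equiv.ext fun d =>
      h.1.injective (g.injective (congrFun hf d))
    rfl
  · intro y
    obtain ⟨⟨⟨M', f'⟩, h', hq'⟩, he⟩ := y
    have hc := Quotient.exact (congrArg Subtype.val he)
    obtain ⟨g, s, hs, hM, hf⟩ := (h.markedMap_equiv_iff h').1 (Setoid.symm hc)
    dsimp only at hM hf hq' h'
    subst hM hf
    exact ⟨⟨g, s, (hQ M f g s hs h hq).1 hq'⟩, rfl⟩

theorem one_mem_rotations (P : RootedPlanarMap D) : 1 ∈ P.rotations :=
  ⟨fun _ => rfl, fun _ => rfl, rfl⟩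

theorem numRotations_pos (P : RootedPlanarMap D) : 0 < P.numRotations := by
  rw [← card_rotations]
  have : Nonempty P.rotations := ⟨⟨1, P.one_mem_rotations⟩⟩
  exact Nat.card_pos

theorem card_occurrence_marked (P : RootedPlanarMap D) (n : ℕ) :
    Nat.card (Occurrence P n fun _ _ => True) =
      numMarkedPattern P n * ((2 * n).factorial * P.numRotations) := by
  rw [card_occurrence P n _ P.rotations subset_rfl (fun _ _ _ s hs _ _ => by simp [hs]),
    card_rotations]
  congr 1
  refine Nat.card_congr (Equiv.subtypeEquivRight fun c => ⟨?_, ?_⟩)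
  · rintro ⟨⟨⟨M, f⟩, h, -⟩, rfl⟩
    exact ⟨h.markedMap, rfl, _, rfl⟩
  · rintro ⟨⟨M, S⟩, rfl, (⟨i, hi⟩ : ∃ i : PatternEmbedding P M, i.marking = S)⟩
    subst hi
    exact ⟨⟨(M, i.toFun), ⟨i.isEmbedding, i.root_notMem⟩, trivial⟩, rfl⟩

/-- Here `H = {1}`: a rotation keeping the pattern at the root fixes `P.root`, hence is trivial by
rigidity. -/
theorem card_occurrence_root (P : RootedPlanarMap D) (n : ℕ) :
    Nat.card (Occurrence P n fun M f => f P.root = M.root) =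
      numRootPattern P n * (2 * n).factorial := by
  rw [card_occurrence P n _ {1} (by simpa using P.one_mem_rotations)]
  · rw [Nat.card_unique (α := ({1} : Set (Equiv.Perm D))), mul_one]
    congr 1
    refine Nat.card_congr (Equiv.subtypeEquivRight fun c => ⟨?_, ?_⟩)
    · rintro ⟨⟨⟨M, f⟩, h, hr⟩, rfl⟩
      exact ⟨h.markedMap, rfl, _, rfl, hr⟩
    · rintro ⟨⟨M, S⟩, rfl,
        (⟨i, hi, hr⟩ : ∃ i : PatternEmbedding P M, i.marking = S ∧ i.toFun P.root = M.root)⟩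
      subst hi
      exact ⟨⟨(M, i.toFun), ⟨i.isEmbedding, i.root_notMem⟩, hr⟩, rfl⟩
  · intro M f g s hs h hr
    change g (f (s P.root)) = g M.root ↔ s = 1
    rw [← hr, g.injective.eq_iff, h.1.injective.eq_iff]
    refine ⟨fun he => Equiv.coe_fn_injective ?_, fun he => by rw [he]; rfl⟩
    exact P.eq_of_commute P.toPlanarMap hs.1 hs.2.1 (fun _ => rfl) (fun _ => rfl) he

/-! ### The double count. -/

/-- A labelled map with an embedding of `P` and a dart is either an occurrence of `P`, rooted at
that dart, or an occurrence at the root with a dart of an inner face of `P`. -/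
theorem card_occurrence_add (P : RootedPlanarMap D) (n : ℕ) :
    Nat.card (Occurrence P n fun _ _ => True) +
      Nat.card (Occurrence P n fun M f => f P.root = M.root) * P.innerValencySum =
    Nat.card (Occurrence P n fun M f => f P.root = M.root) * (2 * n) := by
  let U := {x : PlanarMap (Fin (2 * n)) × (D → Fin (2 * n)) // IsEmbedding P x.1 x.2}
  -- The root is forced to be `f P.root`, which is admissible because `P.root` is not an inner dart.
  have eU : Nat.card (Occurrence P n fun M f => f P.root = M.root) = Nat.card U := by
    refine Nat.card_congr ⟨fun x => ⟨(x.1.1.toPlanarMap, x.1.2), x.2.1.1⟩,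
      fun u => ⟨(⟨u.1.1, u.1.2 P.root⟩, u.1.2), ⟨u.2, ?_⟩, rfl⟩, ?_, fun _ => rfl⟩
    · rintro ⟨d, hd, he⟩
      exact P.root_notMem_innerDarts (u.2.injective he ▸ hd)
    · rintro ⟨⟨M, f⟩, h, hr⟩
      exact Subtype.ext (Prod.ext (ext_root rfl hr) rfl)
  -- This singles out the forbidden roots: darts with an embedded inner face on their left.
  let p : U × Fin (2 * n) → Prop := fun x => x.2 ∈ x.1.1.2 '' P.innerDarts
  have e1 : Nat.card (Occurrence P n fun _ _ => True) = Nat.card {x // ¬ p x} :=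
    Nat.card_congr ⟨fun x => ⟨(⟨(x.1.1.toPlanarMap, x.1.2), x.2.1.1⟩, x.1.1.root), x.2.1.2⟩,
      fun x => ⟨(⟨x.1.1.1.1, x.1.2⟩, x.1.1.1.2), ⟨x.1.1.2, x.2⟩, trivial⟩, fun _ => rfl,
      fun _ => rfl⟩
  have e2 : Nat.card (U × P.innerDarts) = Nat.card {x // p x} := by
    refine Nat.card_congr (Equiv.ofBijective
      (fun x => ⟨(x.1, x.1.1.2 x.2.1), x.2.1, x.2.2, rfl⟩) ⟨?_, ?_⟩)
    · rintro ⟨u, d, hd⟩ ⟨u', d', hd'⟩ he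
      have he := congrArg Subtype.val he
      obtain rfl : u = u' := congrArg Prod.fst he
      obtain rfl : d = d' := u.2.injective (congrArg Prod.snd he)
      rfl
    · rintro ⟨⟨u, y⟩, d, hd, he⟩
      exact ⟨(u, ⟨d, hd⟩), Subtype.ext (Prod.ext rfl he)⟩
  classical
  rw [eU, e1, ← card_innerDarts, ← Nat.card_prod, e2, add_comm, ← Nat.card_sum,
    Nat.card_congr (Equiv.sumCompl p), Nat.card_prod, Nat.card_fin]

theorem numMarkedPattern_mul_numRotations (P : RootedPlanarMap D) (n : ℕ) :
    numMarkedPattern P n * P.numRotations + P.innerValencySum * numRootPattern P n =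
      2 * n * numRootPattern P n := by
  have h := card_occurrence_add P n
  rw [card_occurrence_marked, card_occurrence_root] at h
  refine Nat.eq_of_mul_eq_mul_right (Nat.factorial_pos (2 * n)) ?_
  linear_combination h

end RootedPlanarMap

/-! ### Passage to generating functions. -/

theorem proposition5p1 {D : Type*} [Finite D] (P : RootedPlanarMap D) :
    markedPatternSeries P =
      PowerSeries.C ((P.numRotations : ℚ)⁻¹) *
        (2 * PowerSeries.X * PowerSeries.derivative ℚ (rootPatternSeries P) -
          PowerSeries.C (P.innerValencySum : ℚ) * rootPatternSeries P) := by
  have hX : ∀ n, PowerSeries.coeff n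
      (2 * PowerSeries.X * PowerSeries.derivative ℚ (rootPatternSeries P)) =
        2 * n * (numRootPattern P n : ℚ) := by
    intro n
    rw [mul_assoc, show (2 : PowerSeries ℚ) = PowerSeries.C 2 from rfl, PowerSeries.coeff_C_mul]
    cases n with
    | zero => simp
    | succ n =>
      rw [PowerSeries.coeff_succ_X_mul, PowerSeries.coeff_derivative, rootPatternSeries,
        PowerSeries.coeff_mk]
      push_cast
      ring
  ext n
  have hR : (P.numRotations : ℚ) ≠ 0 := by exact_mod_cast P.numRotations_pos.ne'
  have h : (numMarkedPattern P n : ℚ) * P.numRotations + P.innerValencySum * numRootPattern P n =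
      2 * n * numRootPattern P n := by exact_mod_cast P.numMarkedPattern_mul_numRotations n
  rw [PowerSeries.coeff_C_mul, map_sub, hX, PowerSeries.coeff_C_mul, markedPatternSeries,
    rootPatternSeries, PowerSeries.coeff_mk, PowerSeries.coeff_mk, ← h]
  field_simp
  ring
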